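/- Let $H$ be a separable infinite-dimensional complex Hilbert space, let $\{e_{i,j}\}_{i,j=1}^\infty$ be a system of matrix units in $B(H)$ (that is, $e_{i,j}^*=e_{j,i}$, $e_{i,j}e_{j,l}=e_{i,l}$, and $e_{i,j}e_{k,l}=0$ for $j\neq k$) such that $\{e_{i,i}\}_{i=1}^\infty$ is a maximal family of pairwise orthogonal minimal projections of $B(H)$. Let $B_{sk}(H)=\{a\in B(H): a^*=-a\}$, a real Lie algebra with $[a,b]=ab-ba$. For an arbitrary set $\Omega$ let $F(\Omega,B_{sk}(H))$ be the real Lie algebra of all maps $\Omega\to B_{sk}(H)$ with the pointwise operations and bracket. Write $\hat e_{i,j}$ for the constant map on $\Omega$ with value $e_{i,j}$, put $s_{i,j}=\hat e_{i,j}-\hat e_{j,i}$ for $i\neq j$, and let $I$ be the imaginary unit. Let $(\lambda_n)$ be a sequence of nonzero complex numbers with $\sum_{n=1}^\infty|\lambda_n|^2<\infty$ such that $x_o=\sum_{n=1}^\infty\lambda_n s_{n,n+1}$ belongs to $F(\Omega,B_{sk}(H))$. Let $\mathcal L$ be a real Lie subalgebra of $F(\Omega,B_{sk}(H))$ containing $x_o$,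 all the elements $I\hat e_{i,i}$ $(i\ge 1)$ and all the elements $s_{i,j}$ $(i\neq j)$. Let $\Delta:\mathcal L\to\mathcal L$ be a map, not assumed additive or linear, which is a 2-local spatial derivation implemented by elements of $F(\Omega,B_{sk}(H))$, that is: for all $x,y\in\mathcal L$ there is a derivation $D$ of the Lie algebra $\mathcal L$ with $\Delta(x)=D(x)$ and $\Delta(y)=D(y)$, and for all $x,y\in\mathcal L$ there is $a\in F(\Omega,B_{sk}(H))$ with $\Delta(x)=[a,x]$ and $\Delta(y)=[a,y]$. Then $\Delta$ is a spatial derivation: $\Delta$ is a derivation of $\mathcal L$, and there is one element $\bar a\in F(\Omega,B_{sk}(H))$ such that $\Delta(x)=[\bar a,x]$ for all $x\in\mathcal L$. -/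

import Mathlib

noncomputable section

attribute [local instance] LieRing.ofAssociativeRing

/-- The real Lie algebra of skew-adjoint bounded operators on `H`, with bracket `ab - ba`. -/
def Bsk (H : Type*) [NormedAddCommGroup H] [InnerProductSpace ℂ H] [CompleteSpace H] :
    LieSubalgebra ℝ (H →L[ℂ] H) where
  carrier := {a | star a = -a}
  add_mem' := by
    intro a b ha hb
    simp only [Set.mem_ofPred_eq] at ha hb ⊢
    rw [star_add, ha, hb, neg_add]
  zero_mem' := by simp
  smul_mem' := by
    intro c a ha
    simp only [Set.mem_ofPred_eq] at ha ⊢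
    rw [star_smul, ha, smul_neg, star_trivial]
  lie_mem' := by
    intro a b ha hb
    simp only [Set.mem_ofPred_eq] at ha hb ⊢
    rw [Ring.lie_def, star_sub, star_mul, star_mul, ha, hb, neg_mul_neg, neg_mul_neg, neg_sub]

/-- `FunBsk Ω H` is the set of all maps from `Ω` to `Bsk H`. -/
abbrev FunBsk (Ω H : Type*) [NormedAddCommGroup H] [InnerProductSpace ℂ H] [CompleteSpace H] : Type _ :=
  Ω → Bsk H

/-- The pointwise Lie bracket on `FunBsk Ω H`. -/
instance FunBsk.instLieRing (Ω H : Type*) [NormedAddCommGroup H] [InnerProductSpace ℂ H]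
    [CompleteSpace H] : LieRing (FunBsk Ω H) where
  bracket a b := fun t => ⁅a t, b t⁆
  add_lie a b c := funext fun t => add_lie (a t) (b t) (c t)
  lie_add a b c := funext fun t => lie_add (a t) (b t) (c t)
  lie_self a := funext fun t => lie_self (a t)
  leibniz_lie a b c := funext fun t => leibniz_lie (a t) (b t) (c t)

instance FunBsk.instLieAlgebra (Ω H : Type*) [NormedAddCommGroup H] [InnerProductSpace ℂ H]
    [CompleteSpace H] : LieAlgebra ℝ (FunBsk Ω H) where
  lie_smul r a b := funext fun t => lie_smul r (a t) (b t)

/-- `p` is a minimal (orthogonal) projection in `B(H)`: it is nonzero and has no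
subprojections besides `0` and itself (`q * p = q` says `q ≤ p`). -/
def IsMinimalProjection {H : Type*} [NormedAddCommGroup H] [InnerProductSpace ℂ H]
    [CompleteSpace H] (p : H →L[ℂ] H) : Prop :=
  IsStarProjection p ∧ p ≠ 0 ∧
    ∀ q : H →L[ℂ] H, IsStarProjection q → q * p = q → q = 0 ∨ q = p

/-- A system of matrix units `e i j` in `B(H)` whose diagonal part `e i i` is a maximal
sequence of pairwise orthogonal minimal projections. -/
structure MatrixUnits (H : Type*) [NormedAddCommGroup H] [InnerProductSpace ℂ H]
    [CompleteSpace H] where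
  /-- the matrix units -/
  e : ℕ → ℕ → (H →L[ℂ] H)
  star_e : ∀ i j, star (e i j) = e j i
  mul_e : ∀ i j l, e i j * e j l = e i l
  mul_e_of_ne : ∀ i j k l, j ≠ k → e i j * e k l = 0
  minimal : ∀ i, IsMinimalProjection (e i i)
  maximal : ¬ ∃ q : H →L[ℂ] H, IsMinimalProjection q ∧ ∀ i, q * e i i = 0

namespace MatrixUnits

variable {H : Type*} [NormedAddCommGroup H] [InnerProductSpace ℂ H] [CompleteSpace H]

/-- `s i j = e i j - e j i` as a skew-adjoint operator. -/
def s (u : MatrixUnits H) (i j : ℕ) : Bsk H :=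
  ⟨u.e i j - u.e j i, show star (u.e i j - u.e j i) = -(u.e i j - u.e j i) by
    rw [star_sub, u.star_e, u.star_e, neg_sub]⟩

/-- `I • e i i` as a skew-adjoint operator, where `I` is the imaginary unit. -/
def Ie (u : MatrixUnits H) (i : ℕ) : Bsk H :=
  ⟨Complex.I • u.e i i, show star (Complex.I • u.e i i) = -(Complex.I • u.e i i) by
    rw [star_smul, u.star_e, ← neg_smul]; simp⟩

end MatrixUnits

section LieDerivations

variable {R A : Type*} [CommRing R] [LieRing A] [LieAlgebra R A]

/-- A map `Δ` (not assumed additive or linear) is a 2-local derivation if it agrees on any two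
elements with some derivation. -/
def IsTwoLocalDerivation (R : Type*) {A : Type*} [CommRing R] [LieRing A] [LieAlgebra R A]
    (Δ : A → A) : Prop :=
  ∀ x y : A, ∃ D : LieDerivation R A A, Δ x = D x ∧ Δ y = D y

/-- A spatial derivation on the Lie subalgebra `B` of `A`: a derivation of `B` implemented by an
element of `A`. -/
def IsSpatialDerivation (B : LieSubalgebra R A) (Δ : B → B) : Prop :=
  (∃ D : LieDerivation R B B, ∀ x, Δ x = D x) ∧
    ∃ a : A, ∀ x : B, (Δ x : A) = ⁅a, (x : A)⁆

/-- A 2-local spatial derivation on the Lie subalgebra `B` of `A` implemented by elements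
of `A`. -/
def IsTwoLocalSpatialDerivation (B : LieSubalgebra R A) (Δ : B → B) : Prop :=
  IsTwoLocalDerivation R Δ ∧
    ∀ x y : B, ∃ a : A, (Δ x : A) = ⁅a, (x : A)⁆ ∧ (Δ y : A) = ⁅a, (y : A)⁆

end LieDerivations

end

noncomputable section

attribute [local instance] LieRing.ofAssociativeRing

/-! Evaluation at a point of `Ω` reduces everything to one operator-valued map `d`, and implementing
operators may be chosen point by point. Subtracting the commutator that implements `d` at both `xo`
and `I e₀₀` makes `d` vanish at these two elements; the claim becomes `d = 0`.

Let `T` extend the trace. If one `a` implements `d` at `x` and at a finite-rank `y`, cyclicity gives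
`T(d x · y) = -T(x · d y)` (`pairing`). Testing against matrix units, it follows that the zeros of
`d` are closed under real combinations, and that `d = 0` once `d` kills all skew-adjoint matrix
units. An operator commuting with `z` commutes with `z²`, so by polarization the zeros are also
closed under the Jordan product `i(zz' + z'z)` (`d_jordan`). Jordan products generate the
tridiagonal units from `xo` and `I e₀₀`, and then the remaining ones. -/

/-- `y` may be cycled under the functional `T`. -/
def IsTracial {A : Type*} [Ring A] [Algebra ℂ A] (T : A →ₗ[ℂ] ℂ) (y : A) : Prop :=
  ∀ b c, T (b * y * c) = T (c * b * y)

namespace IsTracial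

variable {A : Type*} [Ring A] [Algebra ℂ A] {T : A →ₗ[ℂ] ℂ}

theorem add {y z : A} (hy : IsTracial T y) (hz : IsTracial T z) : IsTracial T (y + z) := by
  intro b c
  simp only [mul_add, add_mul, map_add, hy b c, hz b c]

theorem sub {y z : A} (hy : IsTracial T y) (hz : IsTracial T z) : IsTracial T (y - z) := by
  intro b c
  simp only [mul_sub, sub_mul, map_sub, hy b c, hz b c]

theorem smul {y : A} (hy : IsTracial T y) (r : ℂ) : IsTracial T (r • y) := by
  intro b c
  simp only [mul_smul_comm, smul_mul_assoc, map_smul, hy b c]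

/-- Invariance of the trace form under `ad a`; only `y` has to be cycled, so `a` and `x` are
arbitrary. -/
theorem commutator_mul {y : A} (hy : IsTracial T y) (a x : A) :
    T ((a * x - x * a) * y) = -T (x * (a * y - y * a)) := by
  have h := hy x a
  simp only [sub_mul, mul_sub, map_sub, mul_assoc] at h ⊢
  rw [h]; ring

theorem mul_commutator_eq_zero {y : A} (hy : IsTracial T y) {a x : A} (h : a * x = x * a) :
    T (x * (a * y - y * a)) = 0 := by
  rw [← neg_eq_zero, ← hy.commutator_mul, h, sub_self, zero_mul, map_zero]

end IsTracial

/-- A ring with matrix units, a functional that behaves like the trace on them and determines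
elements by their entries, and a map `π` of a real vector space whose image contains
the skew-adjoint matrices, together with a `2`-local spatial map `d` along `π`. -/
structure MatrixModel (A V : Type*) [Ring A] [Algebra ℂ A] [AddCommGroup V] [Module ℝ V] where
  e : ℕ → ℕ → A
  T : A →ₗ[ℂ] ℂ
  π : V → A
  d : V → A
  diag : ℕ → V
  skew : ℕ → ℕ → V
  symm : ℕ → ℕ → V
  mul_e : ∀ i j l, e i j * e j l = e i l
  mul_e_of_ne : ∀ i j k l, j ≠ k → e i j * e k l = 0
  tracial_e : ∀ i j, IsTracial T (e i j)
  T_e_self : ∀ i, T (e i i) = 1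
  eq_zero_of_entries : ∀ w, (∀ i j, T (w * e i j) = 0) → w = 0
  corner : ∀ i a, ∃ c : ℂ, e i i * a * e i i = c • e i i
  π_add : ∀ x y, π (x + y) = π x + π y
  π_smul : ∀ (r : ℝ) x, π (r • x) = (r : ℂ) • π x
  twoLocal : ∀ x y, ∃ a, d x = a * π x - π x * a ∧ d y = a * π y - π y * a
  π_diag : ∀ i, π (diag i) = Complex.I • e i i
  π_skew : ∀ i j, i ≠ j → π (skew i j) = e i j - e j i
  π_symm : ∀ i j, i ≠ j → π (symm i j) = Complex.I • (e i j + e j i)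

/-! ### Zeros of a 2-local map in a matrix model -/

namespace MatrixModel

variable {A V : Type*} [Ring A] [Algebra ℂ A] [AddCommGroup V] [Module ℝ V]
  (M : MatrixModel A V)

theorem pairing (x : V) {y : V} (hy : IsTracial M.T (M.π y)) :
    M.T (M.d x * M.π y) = -M.T (M.π x * M.d y) := by
  obtain ⟨a, hx, hya⟩ := M.twoLocal x y
  rw [hx, hya, hy.commutator_mul]

theorem tracial_diag (i : ℕ) : IsTracial M.T (M.π (M.diag i)) := by
  rw [M.π_diag]; exact (M.tracial_e i i).smul _

theorem tracial_skew {i j : ℕ} (h : i ≠ j) : IsTracial M.T (M.π (M.skew i j)) := by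
  rw [M.π_skew i j h]; exact (M.tracial_e i j).sub (M.tracial_e j i)

theorem tracial_symm {i j : ℕ} (h : i ≠ j) : IsTracial M.T (M.π (M.symm i j)) := by
  rw [M.π_symm i j h]; exact ((M.tracial_e i j).add (M.tracial_e j i)).smul _

/-- An element orthogonal to all tracial elements of the image of `π` vanishes. -/
theorem eq_zero_of_pairing {w : A}
    (h : ∀ y, (∃ i j, i ≠ j ∧ (y = M.skew i j ∨ y = M.symm i j)) ∨ (∃ i, y = M.diag i) →
      M.T (w * M.π y) = 0) : w = 0 := by
  apply M.eq_zero_of_entries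
  intro i j
  by_cases hij : i = j
  · subst hij
    have h1 := h (M.diag i) (Or.inr ⟨i, rfl⟩)
    rw [M.π_diag, mul_smul_comm, map_smul, smul_eq_mul] at h1
    exact (mul_eq_zero.mp h1).resolve_left Complex.I_ne_zero
  · have h1 := h (M.skew i j) (Or.inl ⟨i, j, hij, Or.inl rfl⟩)
    have h2 := h (M.symm i j) (Or.inl ⟨i, j, hij, Or.inr rfl⟩)
    rw [M.π_skew i j hij, mul_sub, map_sub] at h1
    rw [M.π_symm i j hij, mul_smul_comm, map_smul, smul_eq_mul, mul_add, map_add] at h2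
    have h3 := (mul_eq_zero.mp h2).resolve_left Complex.I_ne_zero
    linear_combination (h1 + h3) / 2

theorem eq_zero_of_tracial_pairing {w : A}
    (h : ∀ y, IsTracial M.T (M.π y) → M.T (w * M.π y) = 0) : w = 0 := by
  apply M.eq_zero_of_pairing
  rintro y (⟨i, j, hij, rfl | rfl⟩ | ⟨i, rfl⟩)
  · exact h _ (M.tracial_skew hij)
  · exact h _ (M.tracial_symm hij)
  · exact h _ (M.tracial_diag i)

/-- This replaces the missing linearity of `d`: in `pairing` the right side is linear in `π x`. It
also shows that vanishing of `d` depends only on the image under `π`. -/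
theorem d_eq_zero_of_π_eq {x z : V} {r s : ℝ} {y : V} (hx : M.d x = 0) (hz : M.d z = 0)
    (h : M.π y = (r : ℂ) • M.π x + (s : ℂ) • M.π z) : M.d y = 0 := by
  apply M.eq_zero_of_tracial_pairing
  intro w hw
  have h1 := M.pairing x hw
  have h2 := M.pairing z hw
  rw [hx, zero_mul, map_zero] at h1
  rw [hz, zero_mul, map_zero] at h2
  rw [M.pairing y hw, h, add_mul, smul_mul_assoc, smul_mul_assoc, map_add, map_smul, map_smul,
    smul_eq_mul, smul_eq_mul]
  linear_combination -(r : ℂ) * h1 - (s : ℂ) * h2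

theorem d_add_eq_zero {x z : V} (hx : M.d x = 0) (hz : M.d z = 0) : M.d (x + z) = 0 :=
  M.d_eq_zero_of_π_eq (r := 1) (s := 1) hx hz (by simp [M.π_add])

theorem sq_pairing {z y : V} (hz : M.d z = 0) (hy : IsTracial M.T (M.π y)) :
    M.T (M.π z * M.π z * M.d y) = 0 := by
  obtain ⟨a, h1, h2⟩ := M.twoLocal z y
  rw [hz] at h1
  have h1 : a * M.π z = M.π z * a := (sub_eq_zero.mp h1.symm)
  rw [h2]
  apply hy.mul_commutator_eq_zero
  rw [← mul_assoc, h1, mul_assoc, h1, mul_assoc]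

/-- The kernel of `d` is closed under the Jordan product. -/
theorem d_jordan {z z' w : V} (hz : M.d z = 0) (hz' : M.d z' = 0)
    (hw : M.π w = Complex.I • (M.π z * M.π z' + M.π z' * M.π z)) : M.d w = 0 := by
  apply M.eq_zero_of_tracial_pairing
  intro y hy
  have h1 := M.sq_pairing hz hy
  have h2 := M.sq_pairing hz' hy
  -- Polarization: `(z + z')² - z² - z'² = zz' + z'z`.
  have h3 := M.sq_pairing (M.d_add_eq_zero hz hz') hy
  rw [M.pairing w hy, hw, smul_mul_assoc, map_smul, smul_eq_mul, add_mul, map_add]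
  simp only [M.π_add, mul_add, add_mul, map_add] at h3
  linear_combination (-Complex.I) * (h3 - h1 - h2)

/-- If `d` kills two diagonal units, it maps the corresponding off-diagonal elements
into their rotation. -/
theorem exists_commutator {i k : ℕ} (hik : i ≠ k) (hi : M.d (M.diag i) = 0)
    (hk : M.d (M.diag k) = 0) (y : V) :
    ∃ a : A, ∃ α β : ℂ, M.d y = a * M.π y - M.π y * a ∧
      a * M.e i k = α • M.e i k ∧ M.e i k * a = β • M.e i k ∧
      a * M.e k i = β • M.e k i ∧ M.e k i * a = α • M.e k i := by
  -- 2-locality leaves room for one element besides `y`, so both units are encoded in one. The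
  -- distinct nonzero weights 1 and 2 make `e i i` and `e k k` polynomials in `z`, hence anything
  -- commuting with `z` commutes with both.
  have h0 : M.d (M.diag i + (2 : ℝ) • M.diag k) = 0 :=
    M.d_eq_zero_of_π_eq (r := 1) (s := 2) hi hk (by simp [M.π_add, M.π_smul])
  obtain ⟨a, h1, h2⟩ := M.twoLocal (M.diag i + (2 : ℝ) • M.diag k) y
  rw [h0, M.π_add, M.π_smul, M.π_diag, M.π_diag, smul_comm, ← smul_add, mul_smul_comm,
    smul_mul_assoc, ← smul_sub, eq_comm, smul_eq_zero_iff_right Complex.I_ne_zero,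
    sub_eq_zero] at h1
  set z := M.e i i + ((2 : ℝ) : ℂ) • M.e k k with hz
  have hzz : z * z = M.e i i + (4 : ℂ) • M.e k k := by
    rw [hz]
    simp only [mul_add, add_mul, mul_smul_comm, smul_mul_assoc, M.mul_e,
      M.mul_e_of_ne _ _ _ _ hik, M.mul_e_of_ne _ _ _ _ hik.symm, Complex.ofReal_ofNat]
    module
  have hc : Commute a z := h1
  have hki : M.e k k = (1 / 2 : ℂ) • (z * z - z) := by
    rw [hzz, hz, Complex.ofReal_ofNat]; module
  have hii : M.e i i = (2 : ℂ) • z - z * z := by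
    rw [hzz, hz, Complex.ofReal_ofNat]; module
  have ck : Commute a (M.e k k) := by
    rw [hki]; exact ((hc.mul_right hc).sub_right hc).smul_right _
  have ci : Commute a (M.e i i) := by
    rw [hii]; exact (hc.smul_right _).sub_right (hc.mul_right hc)
  obtain ⟨α, hα⟩ := M.corner i a
  obtain ⟨β, hβ⟩ := M.corner k a
  have ha : a * M.e i i = α • M.e i i := by
    rw [← hα, ← ci.eq, mul_assoc, M.mul_e]
  have hb : a * M.e k k = β • M.e k k := by
    rw [← hβ, ← ck.eq, mul_assoc, M.mul_e]
  refine ⟨a, α, β, h2, ?_, ?_, ?_, ?_⟩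
  · rw [← M.mul_e i i k, ← mul_assoc, ha, smul_mul_assoc]
  · rw [← M.mul_e i k k, mul_assoc, ← ck.eq, hb, mul_smul_comm]
  · rw [← M.mul_e k k i, ← mul_assoc, hb, smul_mul_assoc]
  · rw [← M.mul_e k i i, mul_assoc, ← ci.eq, ha, mul_smul_comm]

/-- The commutator rotates `symm i k` into a multiple of `skew i k`. Pairing with the killed `skew i
k`, whose square has trace `-2`, shows that the multiple is zero. -/
theorem d_symm_of_d_skew {i k : ℕ} (hik : i ≠ k) (hi : M.d (M.diag i) = 0)
    (hk : M.d (M.diag k) = 0) (h : M.d (M.skew i k) = 0) : M.d (M.symm i k) = 0 := by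
  obtain ⟨a, α, β, hd, h1, h2, h3, h4⟩ := M.exists_commutator hik hi hk (M.symm i k)
  have hd' : M.d (M.symm i k) = (Complex.I * (α - β)) • (M.e i k - M.e k i) := by
    rw [hd, M.π_symm i k hik, mul_smul_comm, smul_mul_assoc, mul_add, add_mul, h1, h2, h3, h4]
    module
  have hp := M.pairing (M.symm i k) (M.tracial_skew hik)
  rw [h, mul_zero, map_zero, neg_zero, hd', M.π_skew i k hik, smul_mul_assoc, map_smul] at hp
  simp only [mul_sub, sub_mul, M.mul_e, M.mul_e_of_ne _ _ _ _ hik,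
    M.mul_e_of_ne _ _ _ _ hik.symm, map_sub, M.T_e_self, map_zero, smul_eq_mul] at hp
  have : Complex.I * (α - β) = 0 := by linear_combination (-1 / 2 : ℂ) * hp
  rw [hd', this, zero_smul]

theorem d_skew_of_d_symm {i k : ℕ} (hik : i ≠ k) (hi : M.d (M.diag i) = 0)
    (hk : M.d (M.diag k) = 0) (h : M.d (M.symm i k) = 0) : M.d (M.skew i k) = 0 := by
  obtain ⟨a, α, β, hd, h1, h2, h3, h4⟩ := M.exists_commutator hik hi hk (M.skew i k)
  have hd' : M.d (M.skew i k) = (α - β) • (M.e i k + M.e k i) := by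
    rw [hd, M.π_skew i k hik, mul_sub, sub_mul, h1, h2, h3, h4]
    module
  have hp := M.pairing (M.skew i k) (M.tracial_symm hik)
  rw [h, mul_zero, map_zero, neg_zero, hd', M.π_symm i k hik, smul_mul_assoc, map_smul,
    mul_smul_comm, map_smul] at hp
  simp only [mul_add, add_mul, M.mul_e, M.mul_e_of_ne _ _ _ _ hik,
    M.mul_e_of_ne _ _ _ _ hik.symm, map_add, M.T_e_self, map_zero, smul_eq_mul] at hp
  have : (α - β) = 0 := by
    have : Complex.I * (α - β) = 0 := by linear_combination (1 / 2 : ℂ) * hp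
    exact (mul_eq_zero.mp this).resolve_left Complex.I_ne_zero
  rw [hd', this, zero_smul]

/-- The square of `e i k - e k i` is `-(e i i + e k k)`. -/
theorem d_diag_of_d_skew {i k : ℕ} (hik : i ≠ k) (hi : M.d (M.diag i) = 0)
    (h : M.d (M.skew i k) = 0) : M.d (M.diag k) = 0 := by
  have h1 : M.d ((-2 : ℝ) • (M.diag i + M.diag k)) = 0 := by
    refine M.d_jordan h h ?_
    rw [M.π_smul, M.π_add, M.π_diag, M.π_diag, M.π_skew i k hik]
    simp only [mul_sub, sub_mul, M.mul_e, M.mul_e_of_ne _ _ _ _ hik,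
      M.mul_e_of_ne _ _ _ _ hik.symm]
    push_cast
    module
  refine M.d_eq_zero_of_π_eq (r := -1) (s := -1 / 2) hi h1 ?_
  rw [M.π_smul, M.π_add]
  push_cast
  module

theorem d_symm_trans {i j k : ℕ} (hij : i ≠ j) (hjk : j ≠ k) (hik : i ≠ k)
    (h : M.d (M.skew i j) = 0) (h' : M.d (M.skew j k) = 0) : M.d (M.symm i k) = 0 := by
  refine M.d_jordan h h' ?_
  rw [M.π_symm i k hik, M.π_skew i j hij, M.π_skew j k hjk]
  simp only [mul_sub, sub_mul, M.mul_e, M.mul_e_of_ne _ _ _ _ hij, M.mul_e_of_ne _ _ _ _ hjk,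
    M.mul_e_of_ne _ _ _ _ hik, M.mul_e_of_ne _ _ _ _ hij.symm,
    M.mul_e_of_ne _ _ _ _ hjk.symm, M.mul_e_of_ne _ _ _ _ hik.symm]
  module

/-- Climbing the Jacobi chain: the Jordan product of `xo` with the unit `n` isolates the links at
`n`. The earlier link is already killed, and `r n ≠ 0` frees the next one, whose square gives the
unit `n + 1`. -/
theorem d_diag_and_skew_succ {xo : V} {r : ℕ → ℝ} (hr : ∀ n, r n ≠ 0)
    (h0 : M.π xo * M.e 0 0 + M.e 0 0 * M.π xo = (r 0 : ℂ) • (M.e 0 1 - M.e 1 0))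
    (hn : ∀ n, M.π xo * M.e (n + 1) (n + 1) + M.e (n + 1) (n + 1) * M.π xo =
      (r (n + 1) : ℂ) • (M.e (n + 1) (n + 2) - M.e (n + 2) (n + 1)) +
        (r n : ℂ) • (M.e n (n + 1) - M.e (n + 1) n))
    (hxo : M.d xo = 0) (hd : M.d (M.diag 0) = 0) (n : ℕ) :
    M.d (M.diag n) = 0 ∧ M.d (M.skew n (n + 1)) = 0 := by
  induction n with
  | zero =>
    have h1 : M.d ((-r 0) • M.skew 0 1) = 0 := by
      refine M.d_jordan hxo hd ?_
      rw [M.π_smul, M.π_skew 0 1 zero_ne_one, M.π_diag, mul_smul_comm, smul_mul_assoc,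
        ← smul_add, h0, smul_smul, Complex.I_mul_I]
      push_cast
      module
    refine ⟨hd, M.d_eq_zero_of_π_eq (r := -(r 0)⁻¹) (s := 0) h1 h1 ?_⟩
    have := hr 0
    rw [M.π_smul, smul_smul, ← Complex.ofReal_mul, neg_mul_neg, inv_mul_cancel₀ this]
    simp
  | succ n ih =>
    have hd' := M.d_diag_of_d_skew n.succ_ne_self.symm ih.1 ih.2
    have h1 : M.d ((-r (n + 1)) • M.skew (n + 1) (n + 2) + (-r n) • M.skew n (n + 1)) = 0 := by
      refine M.d_jordan hxo hd' ?_
      rw [M.π_add, M.π_smul, M.π_smul, M.π_skew _ _ (by omega), M.π_skew _ _ (by omega),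
        M.π_diag, mul_smul_comm, smul_mul_assoc, ← smul_add, hn, smul_smul, Complex.I_mul_I]
      push_cast
      module
    refine ⟨hd', M.d_eq_zero_of_π_eq (r := -(r (n + 1))⁻¹) (s := -(r (n + 1))⁻¹ * r n) h1 ih.2 ?_⟩
    have : (r (n + 1) : ℂ) ≠ 0 := by exact_mod_cast hr (n + 1)
    rw [M.π_add, M.π_smul, M.π_smul]
    push_cast
    rw [smul_add, smul_smul, smul_smul, neg_mul_neg, inv_mul_cancel₀ this]
    module

/-- A `2`-local spatial map that vanishes at a Jacobi element and at the first diagonal unit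
is zero. -/
theorem d_eq_zero {xo : V} {r : ℕ → ℝ} (hr : ∀ n, r n ≠ 0)
    (h0 : M.π xo * M.e 0 0 + M.e 0 0 * M.π xo = (r 0 : ℂ) • (M.e 0 1 - M.e 1 0))
    (hn : ∀ n, M.π xo * M.e (n + 1) (n + 1) + M.e (n + 1) (n + 1) * M.π xo =
      (r (n + 1) : ℂ) • (M.e (n + 1) (n + 2) - M.e (n + 2) (n + 1)) +
        (r n : ℂ) • (M.e n (n + 1) - M.e (n + 1) n))
    (hxo : M.d xo = 0) (hd : M.d (M.diag 0) = 0) (x : V) : M.d x = 0 := by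
  have hds := M.d_diag_and_skew_succ hr h0 hn hxo hd
  have key : ∀ m i, M.d (M.skew i (i + m + 1)) = 0 ∧ M.d (M.symm i (i + m + 1)) = 0 := by
    intro m
    induction m with
    | zero =>
      intro i
      exact ⟨(hds i).2, M.d_symm_of_d_skew (by omega) (hds _).1 (hds _).1 (hds i).2⟩
    | succ m ih =>
      intro i
      have h := M.d_symm_trans (k := i + (m + 1) + 1) (by omega) (by omega) (by omega) (ih i).1
        (hds (i + m + 1)).2
      exact ⟨M.d_skew_of_d_symm (by omega) (hds _).1 (hds _).1 h, h⟩
  have key' : ∀ i j, i < j → M.d (M.skew i j) = 0 ∧ M.d (M.symm i j) = 0 := by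
    intro i j hij
    obtain ⟨m, rfl⟩ := Nat.exists_eq_add_of_lt hij
    exact key m i
  apply M.eq_zero_of_pairing
  rintro y (⟨i, j, hij, rfl | rfl⟩ | ⟨i, rfl⟩)
  · have : M.d (M.skew i j) = 0 := by
      rcases lt_or_gt_of_ne hij with h | h
      · exact (key' i j h).1
      · refine M.d_eq_zero_of_π_eq (r := -1) (s := 0) (key' j i h).1 (key' j i h).1 ?_
        rw [M.π_skew i j hij, M.π_skew j i hij.symm]
        push_cast
        module
    rw [M.pairing x (M.tracial_skew hij), this, mul_zero, map_zero, neg_zero]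
  · have : M.d (M.symm i j) = 0 := by
      rcases lt_or_gt_of_ne hij with h | h
      · exact (key' i j h).2
      · refine M.d_eq_zero_of_π_eq (r := 1) (s := 0) (key' j i h).2 (key' j i h).2 ?_
        rw [M.π_symm i j hij, M.π_symm j i hij.symm]
        push_cast
        module
    rw [M.pairing x (M.tracial_symm hij), this, mul_zero, map_zero, neg_zero]
  · rw [M.pairing x (M.tracial_diag i), (hds i).1, mul_zero, map_zero, neg_zero]

end MatrixModel

/-! ### A trace functional and rank-one operators -/

open InnerProductSpace in
/-- There is a linear functional on `B(H)` extending the trace of finite rank operators. -/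
theorem exists_trace_rankOne (H : Type*) [NormedAddCommGroup H] [InnerProductSpace ℂ H]
    [CompleteSpace H] :
    ∃ T : (H →L[ℂ] H) →ₗ[ℂ] ℂ, ∀ p q : H, T (rankOne ℂ p q) = inner ℂ q p := by
  obtain ⟨ι, b, -⟩ := exists_hilbertBasis ℂ H
  -- On operators with summable diagonal the trace is a sum; beyond them any algebraic extension
  -- serves, since cycling is needed only through rank-one factors.
  let S : Submodule ℂ (H →L[ℂ] H) :=
    { carrier := {w | Summable fun k => inner ℂ (b k) (w (b k))}
      zero_mem' := by simp
      add_mem' := fun {x y} hx hy => by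
        simpa [inner_add_right] using Summable.add (f := fun k => inner ℂ (b k) (x (b k))) hx hy
      smul_mem' := fun c x hx => by
        simpa [inner_smul_right] using
          Summable.mul_left (f := fun k => inner ℂ (b k) (x (b k))) c hx }
  let T : S →ₗ[ℂ] ℂ :=
    { toFun := fun w => ∑' k, inner ℂ (b k) ((w : H →L[ℂ] H) (b k))
      map_add' := fun x y => by
        rw [← Summable.tsum_add x.2 y.2]
        simp
      map_smul' := fun c x => by
        rw [RingHom.id_apply, smul_eq_mul, ← tsum_mul_left]
        simp }
  obtain ⟨g, hg⟩ := LinearMap.exists_extend T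
  refine ⟨g, fun p q => ?_⟩
  have hs := b.hasSum_inner_mul_inner q p
  have he : (fun k => inner ℂ (b k) ((rankOne ℂ p q) (b k))) =
      fun k => inner ℂ q (b k) * inner ℂ (b k) p := by
    funext k
    rw [rankOne_apply, inner_smul_right]
  have hmem : rankOne ℂ p q ∈ S := show Summable _ by rw [he]; exact hs.summable
  have h1 : g (rankOne ℂ p q) = T ⟨rankOne ℂ p q, hmem⟩ := by rw [← hg]; rfl
  rw [h1, ← hs.tsum_eq]
  exact congrArg tsum he

open InnerProductSpace in
theorem InnerProductSpace.mul_rankOne {H : Type*} [NormedAddCommGroup H]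
    [InnerProductSpace ℂ H] (a : H →L[ℂ] H) (p q : H) :
    a * rankOne ℂ p q = rankOne ℂ (a p) q :=
  comp_rankOne p q a

section
variable {H : Type*} [NormedAddCommGroup H] [InnerProductSpace ℂ H] [CompleteSpace H]

open InnerProductSpace

theorem rankOne_mul (a : H →L[ℂ] H) (p q : H) :
    rankOne ℂ p q * a = rankOne ℂ p (star a q) := rankOne_comp p q a

theorem IsMinimalProjection.exists_eq_rankOne {p : H →L[ℂ] H} (hp : IsMinimalProjection p) :
    ∃ v : H, ‖v‖ = 1 ∧ p = rankOne ℂ v v := by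
  obtain ⟨hproj, hne, hmin⟩ := hp
  obtain ⟨ξ, hξ⟩ : ∃ ξ, p ξ ≠ 0 := by
    by_contra! h
    exact hne (ContinuousLinearMap.ext h)
  have hpp : p (p ξ) = p ξ := congrArg (fun f : H →L[ℂ] H => f ξ) hproj.isIdempotentElem.eq
  refine ⟨((‖p ξ‖ : ℂ)⁻¹) • p ξ, ?_, ?_⟩
  · exact norm_smul_inv_norm hξ
  · set v := ((‖p ξ‖ : ℂ)⁻¹) • p ξ with hv
    have hv1 : ‖v‖ = 1 := norm_smul_inv_norm hξ
    have hpv : p v = v := by rw [hv, map_smul, hpp]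
    have hv0 : v ≠ 0 := by rw [← norm_ne_zero_iff, hv1]; exact one_ne_zero
    rcases hmin (rankOne ℂ v v) (isStarProjection_rankOne_self hv1) (by
      rw [rankOne_mul, hproj.isSelfAdjoint.star_eq, hpv]) with h | h
    · exact absurd h (rankOne_ne_zero hv0 hv0)
    · exact h.symm

theorem isMinimalProjection_rankOne_self {v : H} (hv : ‖v‖ = 1) :
    IsMinimalProjection (rankOne ℂ v v) := by
  have hv0 : v ≠ 0 := by rw [← norm_ne_zero_iff, hv]; exact one_ne_zero
  refine ⟨isStarProjection_rankOne_self hv, rankOne_ne_zero hv0 hv0, fun q hq hle => ?_⟩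
  have h1 : rankOne ℂ v v * q = q := by
    have := congrArg star hle
    rwa [star_mul, hq.isSelfAdjoint.star_eq,
      (isStarProjection_rankOne_self hv).isSelfAdjoint.star_eq] at this
  have hqv : q v = (inner ℂ v (q v)) • v := by
    conv_lhs => rw [← h1]
    rfl
  have hqe : q = (inner ℂ v (q v)) • rankOne ℂ v v := by
    conv_lhs => rw [← hle, mul_rankOne, hqv]
    simp
  set c := inner ℂ v (q v) with hc
  have hcc : c * c = c := by
    have : q (q v) = q v := congrArg (fun f : H →L[ℂ] H => f v) hq.isIdempotentElem.eq
    rw [hqv, map_smul, hqv, smul_smul] at this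
    exact smul_left_injective ℂ hv0 this
  rcases eq_or_ne c 0 with h | h
  · left; rw [hqe, h, zero_smul]
  · right; rw [hqe, mul_left_cancel₀ h (hcc.trans (mul_one c).symm), one_smul]

namespace MatrixUnits

/-- The vectors are `e i 0 v₀`. They are total by maximality: a nonzero vector orthogonal to all of
them would span one more minimal projection. -/
theorem exists_eq_rankOne (u : MatrixUnits H) :
    ∃ v : ℕ → H, (∀ i, ‖v i‖ = 1) ∧ (∀ i j, u.e i j = rankOne ℂ (v i) (v j)) ∧
      ∀ ξ, (∀ i, inner ℂ (v i) ξ = 0) → ξ = 0 := by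
  obtain ⟨v₀, hv₀, h₀⟩ := (u.minimal 0).exists_eq_rankOne
  have he : ∀ i j, u.e i j = rankOne ℂ (u.e i 0 v₀) (u.e j 0 v₀) := by
    intro i j
    rw [← u.mul_e i 0 j, ← u.mul_e 0 0 j, h₀, rankOne_mul, mul_rankOne, u.star_e]
  have hn : ∀ i, ‖u.e i 0 v₀‖ = 1 := by
    intro i
    have h00 : u.e 0 0 v₀ = v₀ := by
      rw [h₀, rankOne_apply, inner_self_eq_norm_sq_to_K, hv₀]; simp
    have h1 : inner ℂ (u.e i 0 v₀) (u.e i 0 v₀) = (1 : ℂ) := by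
      rw [← ContinuousLinearMap.adjoint_inner_right, ← ContinuousLinearMap.star_eq_adjoint,
        u.star_e, ← mul_apply_eq_comp, u.mul_e, h00, inner_self_eq_norm_sq_to_K, hv₀]
      simp
    rw [norm_eq_sqrt_re_inner (𝕜 := ℂ), h1]
    simp
  refine ⟨fun i => u.e i 0 v₀, hn, he, fun ξ hξ => ?_⟩
  by_contra hne
  refine u.maximal ⟨rankOne ℂ (((‖ξ‖ : ℂ)⁻¹) • ξ) (((‖ξ‖ : ℂ)⁻¹) • ξ),
    isMinimalProjection_rankOne_self (norm_smul_inv_norm hne), fun i => ?_⟩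
  rw [he, mul_rankOne, rankOne_apply, inner_smul_left, ← inner_conj_symm, hξ i]
  simp

end MatrixUnits
end

/-! ### Matrix units in `B(H)` as a matrix model -/

section
open InnerProductSpace
variable {H : Type*} [NormedAddCommGroup H] [InnerProductSpace ℂ H] [CompleteSpace H]

theorem isTracial_rankOne {T : (H →L[ℂ] H) →ₗ[ℂ] ℂ}
    (hT : ∀ p q : H, T (rankOne ℂ p q) = inner ℂ q p) (p q : H) :
    IsTracial T (rankOne ℂ p q) := by
  intro b c
  rw [mul_rankOne, rankOne_mul, hT, mul_rankOne, hT, mul_apply_eq_comp,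
    ContinuousLinearMap.star_eq_adjoint, ContinuousLinearMap.adjoint_inner_left]

namespace MatrixUnits

variable (u : MatrixUnits H)

theorem ne_zero (i j : ℕ) : u.e i j ≠ 0 := by
  intro h
  have := u.mul_e i j i
  rw [h, zero_mul] at this
  exact (u.minimal i).2.1 this.symm

theorem coe_s (i j : ℕ) : (u.s i j : H →L[ℂ] H) = u.e i j - u.e j i := rfl

theorem coe_Ie (i : ℕ) : (u.Ie i : H →L[ℂ] H) = Complex.I • u.e i i := rfl

variable {u} {lam : ℕ → ℂ} {X : H →L[ℂ] H}

theorem corner_of_hasSum (hX : HasSum (fun n => lam n • (u.s n (n + 1) : H →L[ℂ] H)) X) (n : ℕ) :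
    u.e n n * X * u.e (n + 1) (n + 1) = lam n • u.e n (n + 1) ∧
      u.e (n + 1) (n + 1) * X * u.e n n = -(lam n • u.e (n + 1) n) := by
  constructor
  · refine ((hX.mul_left (u.e n n)).mul_right (u.e (n + 1) (n + 1))).unique ?_
    convert hasSum_single n _ using 1
    · simp [coe_s, mul_sub, u.mul_e, u.mul_e_of_ne]
    · intro k hk
      have h : u.e n n * u.e (k + 1) k * u.e (n + 1) (n + 1) = 0 := by
        rcases eq_or_ne k (n + 1) with rfl | h
        · rw [u.mul_e_of_ne _ _ _ _ (by omega), zero_mul]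
        · rw [mul_assoc, u.mul_e_of_ne _ _ _ _ h, mul_zero]
      simp [coe_s, mul_sub, u.mul_e_of_ne _ _ _ _ hk.symm, h]
  · refine ((hX.mul_left (u.e (n + 1) (n + 1))).mul_right (u.e n n)).unique ?_
    convert hasSum_single n _ using 1
    · simp [coe_s, mul_sub, u.mul_e, u.mul_e_of_ne]
    · intro k hk
      have h : u.e (n + 1) (n + 1) * u.e k (k + 1) * u.e n n = 0 := by
        rcases eq_or_ne k (n + 1) with rfl | h
        · rw [mul_assoc, u.mul_e_of_ne _ _ _ _ (by omega), mul_zero]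
        · rw [u.mul_e_of_ne _ _ _ _ h.symm, zero_mul]
      simp [coe_s, mul_sub, h, u.mul_e_of_ne (n + 1) (n + 1) (k + 1) k (by omega)]

/-- Skew-adjointness forces real coefficients, as needed for scaling inside a real Lie algebra. -/
theorem ofReal_re_of_hasSum (hX : HasSum (fun n => lam n • (u.s n (n + 1) : H →L[ℂ] H)) X)
    (hskew : star X = -X) (n : ℕ) : ((lam n).re : ℂ) = lam n := by
  obtain ⟨h1, h2⟩ := corner_of_hasSum hX n
  have h3 := congrArg star h1
  rw [star_mul, star_mul, star_smul, u.star_e, u.star_e, u.star_e, hskew, neg_mul, mul_neg,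
    ← mul_assoc, h2, neg_neg] at h3
  exact Complex.conj_eq_iff_re.mp (smul_left_injective ℂ (u.ne_zero _ _) h3).symm

theorem jordan_zero_of_hasSum (hX : HasSum (fun n => lam n • (u.s n (n + 1) : H →L[ℂ] H)) X) :
    X * u.e 0 0 + u.e 0 0 * X = lam 0 • (u.e 0 1 - u.e 1 0) := by
  refine ((hX.mul_right (u.e 0 0)).add (hX.mul_left (u.e 0 0))).unique ?_
  convert hasSum_single 0 _ using 1
  · simp only [coe_s, mul_sub, sub_mul, smul_mul_assoc, mul_smul_comm, zero_add, u.mul_e,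
      u.mul_e_of_ne _ _ _ _ zero_ne_one, u.mul_e_of_ne _ _ _ _ one_ne_zero]
    module
  · intro k hk
    simp [coe_s, mul_sub, sub_mul, u.mul_e_of_ne _ _ _ _ hk, u.mul_e_of_ne _ _ _ _ hk.symm,
      u.mul_e_of_ne]

theorem jordan_succ_of_hasSum (hX : HasSum (fun n => lam n • (u.s n (n + 1) : H →L[ℂ] H)) X)
    (n : ℕ) :
    X * u.e (n + 1) (n + 1) + u.e (n + 1) (n + 1) * X =
      lam (n + 1) • (u.e (n + 1) (n + 2) - u.e (n + 2) (n + 1)) +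
        lam n • (u.e n (n + 1) - u.e (n + 1) n) := by
  refine ((hX.mul_right (u.e (n + 1) (n + 1))).add (hX.mul_left (u.e (n + 1) (n + 1)))).unique ?_
  convert hasSum_sum_of_ne_finset_zero (L := SummationFilter.unconditional ℕ)
    (s := {n + 1, n}) _ using 1
  · rw [Finset.sum_pair n.succ_ne_self]
    simp only [coe_s, mul_sub, sub_mul, smul_mul_assoc, mul_smul_comm, u.mul_e,
      u.mul_e_of_ne _ _ _ _ n.succ_ne_self, u.mul_e_of_ne _ _ _ _ n.succ_ne_self.symm,
      u.mul_e_of_ne _ _ _ _ (n + 1).succ_ne_self, u.mul_e_of_ne _ _ _ _ (n + 1).succ_ne_self.symm]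
    module
  · intro k hk
    simp only [Finset.mem_insert, Finset.mem_singleton, not_or] at hk
    simp [coe_s, mul_sub, sub_mul, u.mul_e_of_ne _ _ _ _ hk.1, u.mul_e_of_ne _ _ _ _ (Ne.symm hk.1),
      u.mul_e_of_ne (n + 1) (n + 1) (k + 1) k (by omega),
      u.mul_e_of_ne k (k + 1) (n + 1) (n + 1) (by omega)]

theorem lie_Ie_s {i j : ℕ} (h : i ≠ j) :
    ((⁅u.Ie i, u.s i j⁆ : Bsk H) : H →L[ℂ] H) = Complex.I • (u.e i j + u.e j i) := by
  rw [LieSubalgebra.coe_bracket, Ring.lie_def, coe_Ie, coe_s]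
  simp only [mul_sub, sub_mul, smul_mul_assoc, mul_smul_comm, u.mul_e, u.mul_e_of_ne _ _ _ _ h,
    u.mul_e_of_ne _ _ _ _ h.symm]
  module

/-- Trace and separation data for a system of matrix units. -/
theorem exists_trace (u : MatrixUnits H) :
    ∃ T : (H →L[ℂ] H) →ₗ[ℂ] ℂ, (∀ i j, IsTracial T (u.e i j)) ∧ (∀ i, T (u.e i i) = 1) ∧
      (∀ w, (∀ i j, T (w * u.e i j) = 0) → w = 0) ∧
      ∀ i a, ∃ c : ℂ, u.e i i * a * u.e i i = c • u.e i i := by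
  obtain ⟨T, hT⟩ := exists_trace_rankOne H
  obtain ⟨v, hv, he, htot⟩ := u.exists_eq_rankOne
  refine ⟨T, fun i j => ?_, fun i => ?_, fun w hw => ?_, fun i a => ?_⟩
  · rw [he]; exact isTracial_rankOne hT _ _
  · rw [he, hT, inner_self_eq_norm_sq_to_K, hv]; simp
  · have h1 : ∀ i, w (v i) = 0 := by
      intro i
      refine htot _ fun j => ?_
      have := hw i j
      rwa [he, mul_rankOne, hT] at this
    have h2 : ∀ i, star w (w (v i)) = 0 := fun i => by rw [h1, map_zero]
    -- Passing to the adjoint lets totality of the `v i` be applied directly, with no density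
    -- argument.
    have h3 : ∀ ξ, star w ξ = 0 := by
      intro ξ
      refine htot _ fun i => ?_
      rw [ContinuousLinearMap.star_eq_adjoint, ContinuousLinearMap.adjoint_inner_right, h1,
        inner_zero_left]
    have h4 : star w = 0 := ContinuousLinearMap.ext h3
    rwa [star_eq_zero] at h4
  · refine ⟨inner ℂ (v i) (a (v i)), ?_⟩
    rw [he, mul_assoc, mul_rankOne, mul_rankOne, rankOne_apply]
    simp

/-- A `2`-local spatial map into the skew-adjoint operators, defined on a real vector space
mapping onto a set that contains the skew-adjoint matrices and a Jacobi operator, is spatial. -/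
theorem exists_implementing {V : Type*} [AddCommGroup V] [Module ℝ V] (u : MatrixUnits H)
    (π : V →ₗ[ℝ] Bsk H) (d : V → Bsk H)
    (h2 : ∀ x y, ∃ a : Bsk H, d x = ⁅a, π x⁆ ∧ d y = ⁅a, π y⁆)
    (hIe : ∀ i, ∃ y, π y = u.Ie i) (hs : ∀ i j, i ≠ j → ∃ y, π y = u.s i j)
    (hIs : ∀ i j, i ≠ j → ∃ y, π y = ⁅u.Ie i, u.s i j⁆)
    (hlam : ∀ n, lam n ≠ 0) (xo : V)
    (hxo : HasSum (fun n => lam n • (u.s n (n + 1) : H →L[ℂ] H)) (π xo : H →L[ℂ] H)) :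
    ∃ a : Bsk H, ∀ x, d x = ⁅a, π x⁆ := by
  obtain ⟨T, hT1, hT2, hT3, hT4⟩ := u.exists_trace
  choose D hD using hIe
  choose! S hS using hs
  choose! B hB using hIs
  -- This `a` is already the final answer: `d - ⁅a, π ·⁆` is again 2-local and vanishes at `xo` and
  -- `D 0`.
  obtain ⟨a, ha1, ha2⟩ := h2 xo (D 0)
  refine ⟨a, fun x => ?_⟩
  let M : MatrixModel (H →L[ℂ] H) V :=
    { e := u.e
      T := T
      π := fun x => (π x : H →L[ℂ] H)
      d := fun x => ((d x - ⁅a, π x⁆ : Bsk H) : H →L[ℂ] H)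
      diag := D
      skew := S
      symm := B
      mul_e := u.mul_e
      mul_e_of_ne := u.mul_e_of_ne
      tracial_e := hT1
      T_e_self := hT2
      eq_zero_of_entries := hT3
      corner := hT4
      π_add := fun x y => by rw [map_add]; rfl
      π_smul := fun r x => by
        rw [map_smul]; exact (Complex.coe_smul r (π x : H →L[ℂ] H)).symm
      twoLocal := fun x y => by
        obtain ⟨b, hb1, hb2⟩ := h2 x y
        refine ⟨((b - a : Bsk H) : H →L[ℂ] H), ?_, ?_⟩
        · rw [hb1, ← sub_lie]; rfl
        · rw [hb2, ← sub_lie]; rfl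
      π_diag := fun i => by rw [hD]; rfl
      π_skew := fun i j h => by rw [hS i j h]; rfl
      π_symm := fun i j h => by rw [hB i j h, lie_Ie_s h] }
  have hre := ofReal_re_of_hasSum hxo (π xo).2
  have h : M.d x = 0 := by
    refine M.d_eq_zero (xo := xo) (r := fun n => (lam n).re) (fun n hn => ?_) ?_ (fun n => ?_)
      ?_ ?_ x
    · exact hlam n (by rw [← hre n, hn, Complex.ofReal_zero])
    · rw [hre]; exact jordan_zero_of_hasSum hxo
    · rw [hre, hre]; exact jordan_succ_of_hasSum hxo n
    · change ((d xo - ⁅a, π xo⁆ : Bsk H) : H →L[ℂ] H) = 0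
      rw [ha1, sub_self]; rfl
    · change ((d (D 0) - ⁅a, π (D 0)⁆ : Bsk H) : H →L[ℂ] H) = 0
      rw [ha2, sub_self]; rfl
  exact sub_eq_zero.mp (Subtype.ext h)

end MatrixUnits
end

/-! ### From pointwise implementation to the theorem -/

/-- A map on a Lie subalgebra that is implemented by a fixed element is a spatial derivation. -/
theorem isSpatialDerivation_of_forall_eq_lie {R A : Type*} [CommRing R] [LieRing A]
    [LieAlgebra R A] {B : LieSubalgebra R A} {Δ : B → B} (a : A)
    (h : ∀ x : B, (Δ x : A) = ⁅a, (x : A)⁆) : IsSpatialDerivation B Δ := by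
  refine ⟨⟨⟨⟨⟨Δ, fun x y => ?_⟩, fun r x => ?_⟩, fun x y => ?_⟩, fun x => rfl⟩, a, h⟩
  · apply Subtype.ext
    simp [h]
  · apply Subtype.ext
    simp [h]
  · apply Subtype.ext
    change (Δ ⁅x, y⁆ : A) = ⁅(x : A), (Δ y : A)⁆ - ⁅(y : A), (Δ x : A)⁆
    rw [h, h, h, LieSubalgebra.coe_bracket, leibniz_lie, ← lie_skew ⁅a, (x : A)⁆]
    abel

end

theorem mainTheorem2 {H : Type*} [NormedAddCommGroup H] [InnerProductSpace ℂ H] [CompleteSpace H]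
    [TopologicalSpace.SeparableSpace H] (hH : ¬ FiniteDimensional ℂ H)
    (u : MatrixUnits H) {Ω : Type*}
    (lam : ℕ → ℂ) (hlam : ∀ n, lam n ≠ 0) (hlam_sum : Summable fun n => ‖lam n‖ ^ 2)
    (xo : FunBsk Ω H)
    (hxo : ∀ t, HasSum (fun n => lam n • (u.s n (n + 1) : H →L[ℂ] H)) (xo t : H →L[ℂ] H))
    (L : LieSubalgebra ℝ (FunBsk Ω H)) (hxoL : xo ∈ L)
    (hIe : ∀ i, (fun _ => u.Ie i : FunBsk Ω H) ∈ L)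
    (hs : ∀ i j, i ≠ j → (fun _ => u.s i j : FunBsk Ω H) ∈ L)
    (Δ : L → L) (hΔ : IsTwoLocalSpatialDerivation L Δ) :
    IsSpatialDerivation L Δ := by
  have key : ∀ t : Ω, ∃ a : Bsk H, ∀ x : L, (Δ x : FunBsk Ω H) t = ⁅a, (x : FunBsk Ω H) t⁆ := by
    intro t
    refine MatrixUnits.exists_implementing u
      ((LinearMap.proj t : FunBsk Ω H →ₗ[ℝ] Bsk H).comp L.toSubmodule.subtype)
      (fun x => (Δ x : FunBsk Ω H) t) (fun x y => ?_) (fun i => ⟨⟨_, hIe i⟩, rfl⟩)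
      (fun i j h => ⟨⟨_, hs i j h⟩, rfl⟩) (fun i j h => ⟨⟨_, L.lie_mem (hIe i) (hs i j h)⟩, rfl⟩)
      hlam ⟨xo, hxoL⟩ (hxo t)
    obtain ⟨a, h1, h2⟩ := hΔ.2 x y
    exact ⟨a t, congrFun h1 t, congrFun h2 t⟩
  choose a ha using key
  exact isSpatialDerivation_of_forall_eq_lie a fun x => funext fun t => ha t x
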